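/- Let $d\ge 2$ and let $S\subset\mathbb{R}^d$ be a closed Lipschitz surface, that is, a closed subset of $\mathbb{R}^d$ (bounded or not) which near each of its points coincides, for some unit vector $e$, with the graph in direction $e$ of a Lipschitz function on the hyperplane $e^\perp$. Let $\sigma$ be the surface measure on $S$, i.e. the $(d-1)$-dimensional Hausdorff measure, and let $n(x)$ be the unit normal to $S$ at $x$ (determined up to sign, wherever $S$ has a tangent hyperplane). Assume that $S$ satisfies the non-resonance condition with respect to $\mathbb{Z}^d$: $$\sigma\big(\{x\in S:\ n(x)\text{ is well-defined and } n(x)\in\mathbb{R}\mathbb{Z}^d\}\big)=0,$$ where $\mathbb{R}\mathbb{Z}^d=\{tk:\ t\in\mathbb{R},\ k\in\mathbb{Z}^d\}$. Let $\mathbb{T}^d=\mathbb{R}^d/\mathbb{Z}^d$ with its normalized Lebesgue measure $dy$, and let $f:S\times\mathbb{T}^d\to\mathbb{R}$ (that is, $f(x,y)$ is 1-periodic in $y\in\mathbb{R}^d$) be such that $f(x,\cdot)$ is continuous for each $x\in S$, $f(\cdot,y)$ is $\sigma$-measurable for each $y$, and $$\int_S \|f(x,\cdot)\|_{C(\mathbb{T}^d)}\,d\sigma(x)<\infty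 .$$ Then $x\mapsto f(x,\lambda x)$ (for every $\lambda\in\mathbb{R}$) and $x\mapsto\int_{\mathbb{T}^d}f(x,y)\,dy$ are $\sigma$-integrable on $S$, and $$\lim_{\lambda\to\infty}\int_S f(x,\lambda x)\,d\sigma(x)=\int_S\int_{\mathbb{T}^d} f(x,y)\,dy\,d\sigma(x).$$ -/

import Mathlib

open MeasureTheory Filter Topology Asymptotics

/-- A Lipschitz surface (hypersurface without boundary) in `ℝ^d`: near each of its points, `S` is
the graph, in the direction of some unit vector `e`, of a Lipschitz function on the hyperplane
orthogonal to `e`. -/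
def IsLipschitzSurface {d : ℕ} (S : Set (EuclideanSpace ℝ (Fin d))) : Prop :=
  ∀ x ∈ S, ∃ (e : EuclideanSpace ℝ (Fin d)) (φ : (Submodule.span ℝ {e})ᗮ → ℝ) (K : NNReal)
    (U : Set (EuclideanSpace ℝ (Fin d))),
    ‖e‖ = 1 ∧ LipschitzWith K φ ∧ IsOpen U ∧ x ∈ U ∧
      ∀ y ∈ U, y ∈ S ↔ inner ℝ e y = φ ((Submodule.span ℝ {e})ᗮ.orthogonalProjectionOnto y)

/-- The surface measure: the `(d-1)`-dimensional Hausdorff measure, in its usual normalization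
(which agrees with Lebesgue measure on hyperplanes), restricted to `S`. -/
noncomputable def surfaceMeasure {d : ℕ} (S : Set (EuclideanSpace ℝ (Fin d))) :
    Measure (EuclideanSpace ℝ (Fin d)) :=
  (Measure.euclideanHausdorffMeasure (d - 1)).restrict S

/-- `ν` is a unit normal to `S` at `x`: the hyperplane through `x` orthogonal to `ν` is tangent to
`S` at `x`, that is, `ν · (y - x) = o(|y - x|)` as `y → x` in `S`. If `S` is near `x` the graph of a
Lipschitz function, such a `ν` exists exactly when that function is differentiable at the point
below `x`, and `ν` is then the usual normal `(∇φ, -1) / √(1 + |∇φ|²)`, up to sign. -/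
def IsUnitNormalAt {d : ℕ} (S : Set (EuclideanSpace ℝ (Fin d)))
    (x ν : EuclideanSpace ℝ (Fin d)) : Prop :=
  ‖ν‖ = 1 ∧ (fun y => inner ℝ ν (y - x)) =o[𝓝[S] x] (fun y => y - x)

/-- `v` is a rational vector: `v ∈ ℝ ℤ^d`. -/
def IsRationalVector {d : ℕ} (v : EuclideanSpace ℝ (Fin d)) : Prop :=
  ∃ (t : ℝ) (k : Fin d → ℤ), ∀ i, v i = t * (k i : ℝ)

/-- The non-resonance condition with respect to `ℤ^d`: the points of `S` at which the unit normal
is well-defined and rational form a set of surface measure zero. -/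
def NonResonant {d : ℕ} (S : Set (EuclideanSpace ℝ (Fin d))) : Prop :=
  surfaceMeasure S {x | x ∈ S ∧ ∃ ν, IsUnitNormalAt S x ν ∧ IsRationalVector ν} = 0

/-- The class of `x ∈ ℝ^d` in the torus `𝕋^d = ℝ^d / ℤ^d`. -/
def toTorus {d : ℕ} (x : EuclideanSpace ℝ (Fin d)) : UnitAddTorus (Fin d) :=
  fun i => (x i : UnitAddCircle)

/-!
By density it is enough to treat `f(x, y) = 1_A(x) e^{2πi k·y}` with `σ(A)` finite: an integrable
`f` is a family in `L¹(σ; C(𝕋^d))`, simple functions are dense there, and trigonometric polynomials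
are dense in `C(𝕋^d)`, while all functionals involved are bounded uniformly in `λ`
(`tendsto_integral_toTorus`). For `k = 0` both sides agree. For `k ≠ 0` the claim is that
`∫_A e^{2πi λ k·x} dσ(x) → 0`, which is the Riemann–Lebesgue lemma for the push-forward of `σ|_A`
under `x ↦ k·x`, as soon as that push-forward is absolutely continuous on the line.

Absolute continuity is where non-resonance enters
(`NonResonant.map_inner_absolutelyContinuous`). Locally `S` is parametrized by a Lipschitz map `G`
on a hyperplane, and `q = k·G` is a Lipschitz function. A Lipschitz function has zero derivative at
almost every point of the preimage of a null set
(`LipschitzWith.ae_hasFDerivAt_zero_of_mem_null`), and a critical point of `q` is a point where `k`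
is normal to `S` (`isUnitNormalAt_of_hasFDerivAt_zero`). Thus almost every `x ∈ S` with `k·x` in a
null set has the rational normal `k / |k|`, and such `x` form a null set by assumption.
-/

/-! ### Preimages of Lebesgue null sets under Lipschitz functions -/

/-- A function that is antilipschitz on `s` pulls Lebesgue null sets back to null subsets of `s`. -/
theorem volume_inter_preimage_eq_zero_of_antilipschitz {u : ℝ → ℝ} {K : NNReal} {s N : Set ℝ}
    (hu : AntilipschitzWith K (s.domRestrict u)) (hN : volume N = 0) :
    volume (s ∩ u ⁻¹' N) = 0 := by
  have h := hu.hausdorffMeasure_preimage_le zero_le_one N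
  rw [hausdorffMeasure_real, hN, mul_zero, nonpos_iff_eq_zero,
    ← (isometry_subtype_coe (s := s)).hausdorffMeasure_image (Or.inl zero_le_one),
    hausdorffMeasure_real] at h
  convert h using 2
  ext t
  simp [Set.domRestrict_apply, and_comm]

theorem volume_deriv_ne_zero_inter_preimage_eq_zero (u : ℝ → ℝ) {N : Set ℝ}
    (hN : volume N = 0) :
    volume {t | DifferentiableAt ℝ u t ∧ deriv u t ≠ 0 ∧ u t ∈ N} = 0 := by
  -- On `A n` the function `u` is antilipschitz at scale `1 / (n + 1)`; the `A n` exhaust the set.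
  let A : ℕ → Set ℝ := fun n =>
    {t | u t ∈ N ∧ ∀ s, |s - t| < 1 / ((n : ℝ) + 1) → |s - t| ≤ n * |u s - u t|}
  have hA : ∀ n, volume (A n) = 0 := by
    intro n
    refine measure_null_of_locally_null _ fun t₀ _ => ?_
    have hδ : (0 : ℝ) < 1 / ((n : ℝ) + 1) := by positivity
    refine ⟨A n ∩ Metric.ball t₀ (1 / ((n : ℝ) + 1) / 2),
      inter_mem_nhdsWithin _ (Metric.ball_mem_nhds _ (by positivity)), ?_⟩
    have hanti : AntilipschitzWith (n : NNReal)
        ((A n ∩ Metric.ball t₀ (1 / ((n : ℝ) + 1) / 2)).domRestrict u) := by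
      refine AntilipschitzWith.of_le_mul_dist fun a b => ?_
      have ha := a.2.2
      have hb := b.2.2
      have hab : dist (a : ℝ) b < 1 / ((n : ℝ) + 1) := by
        rw [Metric.mem_ball] at ha hb
        have := dist_triangle_right (a : ℝ) b t₀
        linarith
      exact b.2.1.2 a hab
    refine measure_mono_null (fun t ht => ?_)
      (volume_inter_preimage_eq_zero_of_antilipschitz hanti hN)
    exact ⟨ht, ht.1.1⟩
  refine measure_mono_null (fun t ht => ?_) (measure_iUnion_null hA)
  obtain ⟨hd, hne, hmem⟩ := ht
  have hO : (fun s => s - t) =O[𝓝 t] fun s => u s - u t := by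
    have h : (fun p : ℝ × ℝ => p.1 - p.2) =O[𝓝 t ×ˢ pure t] fun p => u p.1 - u p.2 :=
      (hd.hasDerivAt.isTheta_sub hne).isBigO_symm
    rwa [prod_pure, isBigO_map] at h
  obtain ⟨c, hc⟩ := hO.bound
  obtain ⟨ε, hε, hball⟩ := Metric.eventually_nhds_iff.1 hc
  obtain ⟨n₁, hn₁⟩ := exists_nat_ge c
  obtain ⟨n₂, hn₂⟩ := exists_nat_one_div_lt hε
  refine Set.mem_iUnion.2 ⟨max n₁ n₂, hmem, fun s hs => ?_⟩
  have h₁ : (n₁ : ℝ) ≤ (max n₁ n₂ : ℕ) := by exact_mod_cast le_max_left _ _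
  have h₂ : (n₂ : ℝ) ≤ (max n₁ n₂ : ℕ) := by exact_mod_cast le_max_right _ _
  have h₃ : 1 / (((max n₁ n₂ : ℕ) : ℝ) + 1) ≤ 1 / ((n₂ : ℝ) + 1) := by gcongr
  have h₄ := hball (y := s) (by rw [Real.dist_eq]; linarith)
  rw [Real.norm_eq_abs, Real.norm_eq_abs] at h₄
  exact h₄.trans (by gcongr; linarith)

/-- Almost everywhere on the preimage of a null set, a Lipschitz function has vanishing derivative:
the one-dimensional statement holds on every line, and Fubini and Rademacher do the rest. -/
theorem LipschitzWith.ae_hasFDerivAt_zero_of_mem_null {E : Type*} [NormedAddCommGroup E]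
    [NormedSpace ℝ E] [FiniteDimensional ℝ E] [MeasurableSpace E] [BorelSpace E] (μ : Measure E)
    [μ.IsAddHaarMeasure] {q : E → ℝ} {K : NNReal} (hq : LipschitzWith K q) {N : Set ℝ}
    (hNm : MeasurableSet N) (hN : volume N = 0) :
    ∀ᵐ z ∂μ, q z ∈ N → HasFDerivAt q (0 : E →L[ℝ] ℝ) z := by
  have hdir : ∀ v : E, ∀ᵐ z ∂μ, z ∈
      ({z | DifferentiableAt ℝ q z} ∩ ({z | fderiv ℝ q z v ≠ 0} ∩ q ⁻¹' N))ᶜ := by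
    intro v
    have hmeas : MeasurableSet
        ({z | DifferentiableAt ℝ q z} ∩ ({z | fderiv ℝ q z v ≠ 0} ∩ q ⁻¹' N))ᶜ := by
      refine ((measurableSet_of_differentiableAt ℝ q).inter (MeasurableSet.inter ?_
        (hq.continuous.measurable hNm))).compl
      exact (measurable_fderiv_apply_const ℝ q v) (measurableSet_singleton 0).compl
    refine ae_mem_of_ae_add_linearMap_mem (LinearMap.toSpanSingleton ℝ E v) volume μ hmeas
      fun y => ?_
    have h := volume_deriv_ne_zero_inter_preimage_eq_zero (fun t : ℝ => q (y + t • v)) hN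
    filter_upwards [measure_eq_zero_iff_ae_notMem.1 h] with t ht hmem
    refine ht ?_
    simp only [LinearMap.toSpanSingleton_apply, Set.mem_inter_iff, Set.mem_ofPred_eq,
      Set.mem_preimage] at hmem
    obtain ⟨hd, hne, hm⟩ := hmem
    have hline : HasDerivAt (fun t : ℝ => y + t • v) v t := by
      simpa using ((hasDerivAt_id t).smul_const v).const_add y
    have hder := hd.hasFDerivAt.comp_hasDerivAt t hline
    refine ⟨hder.differentiableAt, ?_, hm⟩
    have : deriv (fun t : ℝ => q (y + t • v)) t = fderiv ℝ q (y + t • v) v := hder.deriv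
    rwa [this]
  have hbasis := ae_all_iff.2 fun i => hdir (Module.finBasis ℝ E i)
  filter_upwards [hbasis, hq.ae_differentiableAt (μ := μ)] with z hz hdz hzN
  have hzero : fderiv ℝ q z = 0 := by
    have : (fderiv ℝ q z : E →ₗ[ℝ] ℝ) = 0 := by
      refine (Module.finBasis ℝ E).ext fun i => ?_
      by_contra hne
      exact hz i ⟨hdz, hne, hzN⟩
    exact ContinuousLinearMap.coe_injective this
  exact hzero ▸ hdz.hasFDerivAt

/-! ### Level sets of linear functions on Lipschitz surfaces -/

open scoped MeasureTheory in
theorem LipschitzWith.euclideanHausdorffMeasure_image_eq_zero {X Y : Type*} [MetricSpace X]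
    [MetricSpace Y] [MeasurableSpace X] [BorelSpace X] [MeasurableSpace Y] [BorelSpace Y]
    {g : X → Y} {K : NNReal} (hg : LipschitzWith K g) {n : ℕ} {s : Set X} (hs : μHE[n] s = 0) :
    μHE[n] (g '' s) = 0 := by
  have hc := Measure.addHaarScalarFactor_volume_hausdorffMeasure_ne_zero n
  rw [Measure.euclideanHausdorffMeasure_def, Measure.smul_apply, ENNReal.smul_def,
    smul_eq_mul, mul_eq_zero] at hs ⊢
  have h0 : μH[(n : ℝ)] s = 0 := hs.resolve_left (by simpa using hc)
  have h := hg.hausdorffMeasure_image_le (d := n) (Nat.cast_nonneg n) s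
  rw [h0, mul_zero, nonpos_iff_eq_zero] at h
  exact Or.inr h

section Graph

variable {d : ℕ} {e : EuclideanSpace ℝ (Fin d)}

/-- The map `z ↦ z + φ z • e` parametrizing the graph of `φ` in the direction `e`. -/
noncomputable def graphMap (φ : (Submodule.span ℝ {e})ᗮ → ℝ) (z : (Submodule.span ℝ {e})ᗮ) :
    EuclideanSpace ℝ (Fin d) :=
  z + φ z • e

theorem lipschitzWith_graphMap {φ : (Submodule.span ℝ {e})ᗮ → ℝ} {K : NNReal}
    (hφ : LipschitzWith K φ) : ∃ C, LipschitzWith C (graphMap φ) := by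
  have h : LipschitzWith _ fun z => φ z • e :=
    (ContinuousLinearMap.toSpanSingleton ℝ e).lipschitz.comp hφ
  exact ⟨_, (LipschitzWith.subtype_val _).add h⟩

theorem graphMap_orthogonalProjectionOnto (he : ‖e‖ = 1) {φ : (Submodule.span ℝ {e})ᗮ → ℝ}
    {y : EuclideanSpace ℝ (Fin d)}
    (hy : inner ℝ e y = φ ((Submodule.span ℝ {e})ᗮ.orthogonalProjectionOnto y)) :
    graphMap φ ((Submodule.span ℝ {e})ᗮ.orthogonalProjectionOnto y) = y := by
  rw [graphMap, ← hy, Submodule.orthogonalProjectionOnto_orthogonal]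
  simp only [Submodule.starProjection_unit_singleton ℝ he, sub_add_cancel]

/-- At a point where the linear function `inner ℝ w`, read in the graph coordinate, is critical,
`w` is normal to the surface. -/
theorem isUnitNormalAt_of_hasFDerivAt_zero {S U : Set (EuclideanSpace ℝ (Fin d))} (he : ‖e‖ = 1)
    {φ : (Submodule.span ℝ {e})ᗮ → ℝ} (hU : IsOpen U)
    (hgraph : ∀ y ∈ U, y ∈ S ↔
      inner ℝ e y = φ ((Submodule.span ℝ {e})ᗮ.orthogonalProjectionOnto y))
    {x w : EuclideanSpace ℝ (Fin d)} (hxU : x ∈ U) (hxS : x ∈ S) (hw : w ≠ 0)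
    (hder : HasFDerivAt (fun z => inner ℝ w (graphMap φ z))
      (0 : (Submodule.span ℝ {e})ᗮ →L[ℝ] ℝ)
      ((Submodule.span ℝ {e})ᗮ.orthogonalProjectionOnto x)) :
    IsUnitNormalAt S x (‖w‖⁻¹ • w) := by
  refine ⟨by rw [norm_smul, norm_inv, norm_norm, inv_mul_cancel₀ (norm_ne_zero_iff.2 hw)], ?_⟩
  set P := (Submodule.span ℝ {e})ᗮ.orthogonalProjectionOnto with hP
  have hPt : Tendsto P (𝓝[S] x) (𝓝 (P x)) := P.continuous.continuousAt.mono_left inf_le_left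
  have h₁ := hder.isLittleO.comp_tendsto hPt
  have h₂ : (fun y => P y - P x) =O[𝓝[S] x] fun y => y - x := by
    simp_rw [← map_sub]
    exact P.isBigO_comp _ _
  have h₃ : (fun y => inner ℝ w (y - x)) =o[𝓝[S] x] fun y => y - x := by
    refine (h₁.trans_isBigO h₂).congr' ?_ EventuallyEq.rfl
    filter_upwards [self_mem_nhdsWithin, mem_nhdsWithin_of_mem_nhds (hU.mem_nhds hxU)]
      with y hyS hyU
    simp only [Function.comp_apply, zero_apply, sub_zero]
    rw [graphMap_orthogonalProjectionOnto he ((hgraph y hyU).1 hyS),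
      graphMap_orthogonalProjectionOnto he ((hgraph x hxU).1 hxS), inner_sub_right]
  simp_rw [real_inner_smul_left]
  exact h₃.const_mul_left _

end Graph

/-- The Sard-type property of a Lipschitz surface: almost every point of the surface whose height
in the direction `w` lies in a given Lebesgue null set has normal direction `w`. -/
theorem IsLipschitzSurface.surfaceMeasure_not_isUnitNormalAt_eq_zero {d : ℕ} (hd : d ≠ 0)
    {S : Set (EuclideanSpace ℝ (Fin d))} (hS : IsLipschitzSurface S)
    {w : EuclideanSpace ℝ (Fin d)} (hw : w ≠ 0) {N : Set ℝ} (hNm : MeasurableSet N)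
    (hN : volume N = 0) :
    surfaceMeasure S {x | x ∈ S ∧ inner ℝ w x ∈ N ∧ ¬ IsUnitNormalAt S x (‖w‖⁻¹ • w)} = 0 := by
  refine nonpos_iff_eq_zero.1 ((Measure.restrict_apply_le _ _).trans_eq ?_)
  refine measure_null_of_locally_null _ fun x₀ hx₀ => ?_
  obtain ⟨e, φ, K, U, he, hφ, hU, hxU, hgraph⟩ := hS x₀ hx₀.1
  refine ⟨_ ∩ U, inter_mem_nhdsWithin _ (hU.mem_nhds hxU), ?_⟩
  obtain ⟨C, hC⟩ := lipschitzWith_graphMap hφ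
  have hq : LipschitzWith _ fun z => inner ℝ w (graphMap φ z) :=
    (innerSL ℝ w).lipschitz.comp hC
  have hrank : Module.finrank ℝ (Submodule.span ℝ {e})ᗮ = d - 1 := by
    have : Fact (Module.finrank ℝ (EuclideanSpace ℝ (Fin d)) = (d - 1) + 1) :=
      ⟨by rw [finrank_euclideanSpace_fin]; omega⟩
    exact Submodule.finrank_orthogonal_span_singleton (norm_ne_zero_iff.1 (by simp [he]))
  have hae := hq.ae_hasFDerivAt_zero_of_mem_null
    (Measure.euclideanHausdorffMeasure (Module.finrank ℝ (Submodule.span ℝ {e})ᗮ)) hNm hN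
  rw [hrank, ae_iff] at hae
  refine measure_mono_null ?_ (hC.euclideanHausdorffMeasure_image_eq_zero hae)
  rintro x ⟨⟨hxS, hxN, hnot⟩, hxU⟩
  have hx := graphMap_orthogonalProjectionOnto he ((hgraph x hxU).1 hxS)
  refine ⟨_, fun h => hnot ?_, hx⟩
  exact isUnitNormalAt_of_hasFDerivAt_zero he hU hgraph hxU hxS hw (h (by rwa [hx]))

/-- On a non-resonant surface, the distribution of an integer linear function is absolutely
continuous. -/
theorem NonResonant.map_inner_absolutelyContinuous {d : ℕ} (hd : d ≠ 0)
    {S : Set (EuclideanSpace ℝ (Fin d))} (hSm : MeasurableSet S) (hS : IsLipschitzSurface S)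
    (hres : NonResonant S) {w : EuclideanSpace ℝ (Fin d)} (hw : w ≠ 0)
    (hwr : IsRationalVector w) :
    (surfaceMeasure S).map (fun x => inner ℝ w x) ≪ volume := by
  refine Measure.AbsolutelyContinuous.mk fun N hNm hN => ?_
  rw [Measure.map_apply (by fun_prop) hNm]
  have hrat : IsRationalVector (‖w‖⁻¹ • w) := by
    obtain ⟨t, k, hk⟩ := hwr
    exact ⟨‖w‖⁻¹ * t, k, fun i => by simp [hk i, mul_assoc]⟩
  have hSc : surfaceMeasure S Sᶜ = 0 := by
    rw [surfaceMeasure, Measure.restrict_apply hSm.compl, Set.compl_inter_self, measure_empty]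
  refine measure_mono_null (fun x hx => ?_) (measure_union_null (measure_union_null hres
    (hS.surfaceMeasure_not_isUnitNormalAt_eq_zero hd hw hNm hN)) hSc)
  by_cases hxS : x ∈ S
  · by_cases hn : IsUnitNormalAt S x (‖w‖⁻¹ • w)
    · exact Or.inl (Or.inl ⟨hxS, _, hn, hrat⟩)
    · exact Or.inl (Or.inr ⟨hxS, hx, hn⟩)
  · exact Or.inr hxS

/-! ### Riemann–Lebesgue lemma on the surface -/

theorem tendsto_integral_fourierChar_of_absolutelyContinuous {ν : Measure ℝ} [IsFiniteMeasure ν]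
    (hν : ν ≪ volume) :
    Tendsto (fun l : ℝ => ∫ v, (Real.fourierChar (l * v) : ℂ) ∂ν) atTop (𝓝 0) := by
  have h := (Real.tendsto_integral_exp_smul_cocompact
    fun v => ((ν.rnDeriv volume v).toReal : ℂ)).comp
      (tendsto_neg_atTop_atBot.mono_right (atBot_le_cocompact (α := ℝ)))
  refine h.congr fun l => ?_
  rw [← integral_rnDeriv_smul hν, Function.comp_apply]
  refine integral_congr_ae (Eventually.of_forall fun v => ?_)
  simp only [Circle.smul_def, smul_eq_mul, Complex.real_smul]
  rw [mul_comm]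
  congr 3
  ring

theorem mFourier_toTorus_smul {d : ℕ} (k : Fin d → ℤ) (l : ℝ) (x : EuclideanSpace ℝ (Fin d)) :
    UnitAddTorus.mFourier k (toTorus (l • x)) =
      Real.fourierChar (l * inner ℝ (WithLp.toLp 2 fun i => (k i : ℝ)) x) := by
  simp only [UnitAddTorus.mFourier, ContinuousMap.coe_mk, toTorus, fourier_coe_apply,
    Real.fourierChar_apply, ← Complex.exp_sum]
  congr 1
  simp only [PiLp.inner_apply, PiLp.smul_apply, smul_eq_mul, RCLike.inner_apply, conj_trivial]
  push_cast
  simp only [Finset.mul_sum, Finset.sum_mul]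
  refine Finset.sum_congr rfl fun i _ => ?_
  ring

theorem integral_mFourier_eq_zero {d : ℕ} {k : Fin d → ℤ} (hk : k ≠ 0) :
    ∫ y, UnitAddTorus.mFourier k y = 0 := by
  obtain ⟨i, hi⟩ := Function.ne_iff.1 hk
  have hsplit : ∫ y, UnitAddTorus.mFourier k y =
      ∏ i, ∫ t : UnitAddCircle, (fourier (k i) t : ℂ) :=
    integral_fintype_prod_volume_eq_prod fun i (t : UnitAddCircle) => (fourier (k i) t : ℂ)
  rw [hsplit]
  refine Finset.prod_eq_zero (Finset.mem_univ i) ?_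
  -- Translating by half a period changes the sign of the integrand.
  have h := integral_add_right_eq_self (μ := (volume : Measure UnitAddCircle))
    (fun t : UnitAddCircle => (fourier (k i) t : ℂ)) ((1 / 2 / (k i : ℝ) : ℝ) : UnitAddCircle)
  simp_rw [fourier_add_half_inv_index hi one_pos, integral_neg] at h
  exact self_eq_neg.1 h.symm

/-- The phase `k · x` has an absolutely continuous distribution on any part of the surface of finite
measure, so the Riemann–Lebesgue lemma for its density applies. -/
theorem NonResonant.tendsto_setIntegral_mFourier {d : ℕ}
    {S : Set (EuclideanSpace ℝ (Fin d))} (hSm : MeasurableSet S) (hS : IsLipschitzSurface S)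
    (hres : NonResonant S) {k : Fin d → ℤ} (hk : k ≠ 0) {s : Set (EuclideanSpace ℝ (Fin d))}
    (hs : surfaceMeasure S s < ⊤) :
    Tendsto (fun l : ℝ => ∫ x in s, UnitAddTorus.mFourier k (toTorus (l • x)) ∂surfaceMeasure S)
      atTop (𝓝 0) := by
  obtain ⟨i, hi⟩ := Function.ne_iff.1 hk
  set w : EuclideanSpace ℝ (Fin d) := WithLp.toLp 2 fun i => (k i : ℝ) with hw
  have hw0 : w ≠ 0 := fun h => hi (by simpa [hw] using congrArg (fun v => v i) h)
  have hd : d ≠ 0 := fun h => (h ▸ i).elim0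
  have hac : ((surfaceMeasure S).restrict s).map (fun x => inner ℝ w x) ≪ volume :=
    (Measure.absolutelyContinuous_of_le Measure.restrict_le_self |>.map (by fun_prop)).trans
      (hres.map_inner_absolutelyContinuous hd hSm hS hw0 ⟨1, k, fun i => by simp [hw]⟩)
  have : IsFiniteMeasure ((surfaceMeasure S).restrict s) := ⟨by simpa using hs⟩
  refine (tendsto_integral_fourierChar_of_absolutelyContinuous hac).congr fun l => ?_
  rw [integral_map (by fun_prop) (by fun_prop)]
  simp_rw [mFourier_toTorus_smul, hw]

/-! ### Averaging of integrable families of continuous functions on the torus -/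

theorem continuous_toTorus {d : ℕ} : Continuous (toTorus (d := d)) :=
  continuous_pi fun i => (AddCircle.continuous_mk' 1).comp (by fun_prop)

theorem integrable_eval_toTorus {d : ℕ} {μ : Measure (EuclideanSpace ℝ (Fin d))}
    {F : EuclideanSpace ℝ (Fin d) → C(UnitAddTorus (Fin d), ℂ)} (hF : Integrable F μ) (l : ℝ) :
    Integrable (fun x => F x (toTorus (l • x))) μ := by
  refine hF.norm.mono' ?_ (Eventually.of_forall fun x => (F x).norm_coe_le_norm _)
  have hg : Continuous fun x : EuclideanSpace ℝ (Fin d) => toTorus (l • x) :=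
    continuous_toTorus.comp (by fun_prop)
  exact (continuous_eval (F := C(UnitAddTorus (Fin d), ℂ))).comp_aestronglyMeasurable
    (hF.aestronglyMeasurable.prodMk hg.aestronglyMeasurable)

/-- The integral over the torus (a mean value, the total mass being one), as a continuous linear
functional on continuous functions. -/
noncomputable def unitAddTorusMean (d : ℕ) : C(UnitAddTorus (Fin d), ℂ) →L[ℂ] ℂ :=
  LinearMap.mkContinuous
    { toFun := fun c => ∫ y, c y
      map_add' := fun c c' => integral_add
        (c.continuous.integrable_of_hasCompactSupport (HasCompactSupport.of_compactSpace _))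
        (c'.continuous.integrable_of_hasCompactSupport (HasCompactSupport.of_compactSpace _))
      map_smul' := fun a c => integral_const_mul a _ }
    ((volume : Measure (UnitAddTorus (Fin d))).real Set.univ) fun c => by
      rw [mul_comm]
      exact norm_integral_le_of_norm_le_const (Eventually.of_forall c.norm_coe_le_norm)

theorem unitAddTorusMean_apply {d : ℕ} (c : C(UnitAddTorus (Fin d), ℂ)) :
    unitAddTorusMean d c = ∫ y, c y := rfl

theorem isClosed_setOf_tendsto_of_lipschitz {V : Type*} [PseudoMetricSpace V] {A : ℝ → V → ℂ}
    {B : V → ℂ} {K : NNReal} (hA : ∀ l, LipschitzWith K (A l)) (hB : Continuous B) :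
    IsClosed {v | Tendsto (fun l => A l v) atTop (𝓝 (B v))} :=
  (LipschitzWith.uniformEquicontinuous A K hA).equicontinuous.isClosed_setOfPred_tendsto hB

/-- Averaging for a single continuous function on the torus, by density of trigonometric
polynomials. -/
theorem tendsto_setIntegral_toTorus {d : ℕ} {μ : Measure (EuclideanSpace ℝ (Fin d))}
    {s : Set (EuclideanSpace ℝ (Fin d))} (hs : μ s < ⊤)
    (hμ : ∀ k : Fin d → ℤ, k ≠ 0 → Tendsto
      (fun l : ℝ => ∫ x in s, UnitAddTorus.mFourier k (toTorus (l • x)) ∂μ) atTop (𝓝 0))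
    (c : C(UnitAddTorus (Fin d), ℂ)) :
    Tendsto (fun l : ℝ => ∫ x in s, c (toTorus (l • x)) ∂μ) atTop
      (𝓝 (∫ _ in s, unitAddTorusMean d c ∂μ)) := by
  have : IsFiniteMeasure (μ.restrict s) := ⟨by simpa using hs⟩
  have hint : ∀ (c : C(UnitAddTorus (Fin d), ℂ)) (l : ℝ),
      Integrable (fun x => c (toTorus (l • x))) (μ.restrict s) := fun c l =>
    integrable_eval_toTorus (integrable_const c) l
  have hclosed := isClosed_setOf_tendsto_of_lipschitz
    (A := fun l (c : C(UnitAddTorus (Fin d), ℂ)) => ∫ x in s, c (toTorus (l • x)) ∂μ)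
    (B := fun c => ∫ _ in s, unitAddTorusMean d c ∂μ) (K := (μ.real s).toNNReal) (fun l => by
      refine LipschitzWith.of_dist_le_mul fun c c' => ?_
      rw [dist_eq_norm, dist_eq_norm, ← integral_sub (hint c l) (hint c' l),
        Real.coe_toNNReal _ measureReal_nonneg, mul_comm]
      exact norm_setIntegral_le_of_norm_le_const hs fun x _ => (c - c').norm_coe_le_norm _)
    (by simp only [integral_const]; fun_prop)
  have hspan : (Submodule.span ℂ (Set.range (UnitAddTorus.mFourier (d := Fin d))) :
      Set C(UnitAddTorus (Fin d), ℂ)) ⊆ {c | Tendsto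
        (fun l : ℝ => ∫ x in s, c (toTorus (l • x)) ∂μ) atTop
          (𝓝 (∫ _ in s, unitAddTorusMean d c ∂μ))} := by
    intro c hc
    induction hc using Submodule.span_induction with
    | mem c hc =>
      obtain ⟨k, rfl⟩ := hc
      by_cases hk : k = 0
      · subst hk
        simp only [Set.mem_ofPred_eq, unitAddTorusMean_apply, UnitAddTorus.mFourier_zero,
          ContinuousMap.one_apply, integral_const]
        simp [Measure.real, volume_pi, Measure.pi_univ]
      · simpa [unitAddTorusMean_apply, integral_mFourier_eq_zero hk] using hμ k hk
    | zero => simp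
    | add c c' _ _ h h' =>
      simp only [Set.mem_ofPred_eq, map_add, ContinuousMap.add_apply] at h h' ⊢
      simp_rw [integral_add (hint c _) (hint c' _)]
      rw [integral_add (integrable_const _) (integrable_const _)]
      exact h.add h'
    | smul a c _ h =>
      simp only [Set.mem_ofPred_eq, map_smul, ContinuousMap.smul_apply, integral_smul] at h ⊢
      exact h.const_smul a
  have htop := closure_minimal hspan hclosed
  rw [← Submodule.topologicalClosure_coe, UnitAddTorus.span_mFourier_closure_eq_top] at htop
  exact htop (Set.mem_univ c)

/-- If all nontrivial characters oscillate to zero on sets of finite measure, then every integrable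
family of continuous functions on the torus averages out: such families are `L¹` limits of simple
ones. -/
theorem tendsto_integral_toTorus {d : ℕ} {μ : Measure (EuclideanSpace ℝ (Fin d))}
    (hμ : ∀ k : Fin d → ℤ, k ≠ 0 → ∀ s, μ s < ⊤ → Tendsto
      (fun l : ℝ => ∫ x in s, UnitAddTorus.mFourier k (toTorus (l • x)) ∂μ) atTop (𝓝 0))
    {F : EuclideanSpace ℝ (Fin d) → C(UnitAddTorus (Fin d), ℂ)} (hF : Integrable F μ) :
    Tendsto (fun l : ℝ => ∫ x, F x (toTorus (l • x)) ∂μ) atTop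
      (𝓝 (∫ x, unitAddTorusMean d (F x) ∂μ)) := by
  refine Integrable.induction (μ := μ)
    (P := fun F : EuclideanSpace ℝ (Fin d) → C(UnitAddTorus (Fin d), ℂ) =>
      Tendsto (fun l : ℝ => ∫ x, F x (toTorus (l • x)) ∂μ) atTop
        (𝓝 (∫ x, unitAddTorusMean d (F x) ∂μ))) ?_ ?_ ?_ ?_ hF
  · intro c s hsm hs
    have h := tendsto_setIntegral_toTorus hs (fun k hk => hμ k hk s hs) c
    have h₁ : ∀ l : ℝ, (fun x => (s.indicator (fun _ => c) x) (toTorus (l • x))) =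
        s.indicator fun x => c (toTorus (l • x)) := fun l => by
      ext x
      by_cases hx : x ∈ s <;> simp [hx]
    have h₂ : (fun x => unitAddTorusMean d (s.indicator (fun _ => c) x)) =
        s.indicator fun _ => unitAddTorusMean d c := by
      ext x
      by_cases hx : x ∈ s <;> simp [hx]
    simpa only [h₁, h₂, integral_indicator hsm] using h
  · intro f g _ hf hg hPf hPg
    simp only [Pi.add_apply, ContinuousMap.add_apply, map_add]
    simp_rw [integral_add (integrable_eval_toTorus hf _) (integrable_eval_toTorus hg _)]
    rw [integral_add ((unitAddTorusMean d).integrable_comp hf)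
      ((unitAddTorusMean d).integrable_comp hg)]
    exact hPf.add hPg
  · refine isClosed_setOf_tendsto_of_lipschitz (K := 1)
      (A := fun l (F : Lp C(UnitAddTorus (Fin d), ℂ) 1 μ) => ∫ x, F x (toTorus (l • x)) ∂μ)
      (fun l => LipschitzWith.of_dist_le_mul fun f g => ?_) ?_
    · have hf := L1.integrable_coeFn f
      have hg := L1.integrable_coeFn g
      rw [NNReal.coe_one, one_mul, dist_eq_norm, dist_eq_norm, L1.norm_eq_integral_norm,
        ← integral_sub (integrable_eval_toTorus hf l) (integrable_eval_toTorus hg l)]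
      refine norm_integral_le_of_norm_le (L1.integrable_coeFn (f - g)).norm ?_
      filter_upwards [Lp.coeFn_sub f g] with x hx
      rw [hx]
      exact (f x - g x).norm_coe_le_norm _
    · have : (fun F : Lp C(UnitAddTorus (Fin d), ℂ) 1 μ => ∫ x, unitAddTorusMean d (F x) ∂μ) =
          fun F => unitAddTorusMean d (∫ x, F x ∂μ) := by
        ext F
        exact (unitAddTorusMean d).integral_comp_comm (L1.integrable_coeFn F)
      rw [this]
      exact (unitAddTorusMean d).continuous.comp continuous_integral
  · intro f g hfg _ hPf
    have h₁ : ∀ l : ℝ, ∫ x, f x (toTorus (l • x)) ∂μ = ∫ x, g x (toTorus (l • x)) ∂μ := fun l =>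
      integral_congr_ae (hfg.mono fun x hx => by simp only [hx])
    have h₂ : ∫ x, unitAddTorusMean d (f x) ∂μ = ∫ x, unitAddTorusMean d (g x) ∂μ :=
      integral_congr_ae (hfg.mono fun x hx => by simp only [hx])
    simpa only [h₁, h₂] using hPf

/-- A family of continuous functions on a compact metrizable space that is pointwise measurable is
measurable for the topology of uniform convergence: evaluation at a dense sequence is a continuous
injection between Polish spaces. -/
theorem aestronglyMeasurable_continuousMap {X T : Type*} [MeasurableSpace X] {μ : Measure X}
    [TopologicalSpace T] [CompactSpace T] [TopologicalSpace.MetrizableSpace T] [Nonempty T]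
    {F : X → C(T, ℂ)} (hF : ∀ y, AEMeasurable (fun x => F x y) μ) :
    AEStronglyMeasurable F μ := by
  let _ : MetricSpace T := TopologicalSpace.metrizableSpaceMetric T
  let _ : MeasurableSpace C(T, ℂ) := borel _
  have : BorelSpace C(T, ℂ) := ⟨rfl⟩
  let ι : C(T, ℂ) → ℕ → ℂ := fun c n => c (TopologicalSpace.denseSeq T n)
  have hι : Continuous ι := continuous_pi fun n => continuous_eval_const _
  have hinj : Function.Injective ι := fun c c' h => by
    refine DFunLike.coe_injective ((TopologicalSpace.denseRange_denseSeq T).equalizer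
      c.continuous c'.continuous h)
  refine AEMeasurable.aestronglyMeasurable ?_
  refine (hι.measurableEmbedding hinj).aemeasurable_comp_iff.1 ?_
  exact aemeasurable_pi_lambda _ fun n => hF _

theorem ContinuousMap.enorm_le_iSup_enorm_apply {T E : Type*} [TopologicalSpace T]
    [CompactSpace T] [NormedAddCommGroup E] (c : C(T, E)) : ‖c‖ₑ ≤ ⨆ y, ‖c y‖ₑ := by
  by_cases htop : (⨆ y, ‖c y‖ₑ) = ⊤
  · rw [htop]
    exact le_top
  rw [← ENNReal.ofReal_toReal htop, ← ofReal_norm]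
  refine ENNReal.ofReal_le_ofReal ((ContinuousMap.norm_le _ ENNReal.toReal_nonneg).2 fun y => ?_)
  rw [← toReal_enorm]
  exact ENNReal.toReal_mono htop (le_iSup (fun y => ‖c y‖ₑ) y)

/-! ### The averaging theorem -/

theorem theorem2p1 (d : ℕ) (hd : 2 ≤ d) (S : Set (EuclideanSpace ℝ (Fin d)))
    (hS_closed : IsClosed S) (hS_lip : IsLipschitzSurface S) (hS_res : NonResonant S)
    (f : EuclideanSpace ℝ (Fin d) → UnitAddTorus (Fin d) → ℝ)
    (hf_meas : ∀ y, AEMeasurable (fun x => f x y) (surfaceMeasure S))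
    (hf_cont : ∀ x ∈ S, Continuous (f x))
    (hf_int : ∫⁻ x, (⨆ y, ‖f x y‖ₑ) ∂(surfaceMeasure S) < ⊤) :
    (∀ l : ℝ, Integrable (fun x => f x (toTorus (l • x))) (surfaceMeasure S)) ∧
    Integrable (fun x => ∫ y, f x y) (surfaceMeasure S) ∧
    Tendsto (fun l : ℝ => ∫ x, f x (toTorus (l • x)) ∂(surfaceMeasure S)) atTop
      (𝓝 (∫ x, (∫ y, f x y) ∂(surfaceMeasure S))) := by
  classical
  -- Off `S` the function `f x` may be discontinuous; those `x` form a null set.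
  let F : EuclideanSpace ℝ (Fin d) → C(UnitAddTorus (Fin d), ℂ) := fun x =>
    if h : Continuous (f x) then ⟨fun y => (f x y : ℂ), Complex.continuous_ofReal.comp h⟩ else 0
  have hFf : ∀ᵐ x ∂surfaceMeasure S, ∀ y, F x y = (f x y : ℂ) :=
    (ae_restrict_mem hS_closed.measurableSet).mono fun x hx y => by
      simp only [F, dif_pos (hf_cont x hx), ContinuousMap.coe_mk]
  have hF : Integrable F (surfaceMeasure S) := by
    refine ⟨aestronglyMeasurable_continuousMap fun y => ?_, ?_⟩
    · exact (Complex.measurable_ofReal.comp_aemeasurable (hf_meas y)).congr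
        (hFf.mono fun x hx => (hx y).symm)
    · refine (lintegral_mono_ae (hFf.mono fun x hx => ?_)).trans_lt hf_int
      refine (F x).enorm_le_iSup_enorm_apply.trans (iSup_mono fun y => ?_)
      rw [hx y, ← ofReal_norm, ← ofReal_norm, Complex.norm_real]
  have hev : ∀ l : ℝ, (fun x => F x (toTorus (l • x))) =ᵐ[surfaceMeasure S]
      fun x => (f x (toTorus (l • x)) : ℂ) := fun l => hFf.mono fun x hx => hx _
  have hav : (fun x => unitAddTorusMean d (F x)) =ᵐ[surfaceMeasure S]
      fun x => ((∫ y, f x y : ℝ) : ℂ) := hFf.mono fun x hx => by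
    simp only [unitAddTorusMean_apply, hx]
    exact integral_ofReal
  refine ⟨fun l => ?_, ?_, ?_⟩
  · exact ((integrable_eval_toTorus hF l).congr (hev l)).re
  · exact (((unitAddTorusMean d).integrable_comp hF).congr hav).re
  · have h := tendsto_integral_toTorus (fun k hk s hs =>
      hS_res.tendsto_setIntegral_mFourier hS_closed.measurableSet hS_lip hk hs) hF
    simp_rw [integral_congr_ae (hev _)] at h
    rw [integral_congr_ae hav] at h
    simp_rw [integral_complex_ofReal] at h
    exact (Complex.continuous_re.tendsto _).comp h
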